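/- **Setting.** For a finite group $G$ acting on a finite set $X$, the cycle type of $g\in G$ on $X$ is the multiset $c(g)=\{1^{c_1},2^{c_2},\dots\}$, where $c_i$ is the number of $i$-cycles of the permutation of $X$ induced by $g$, and the cycle index is $\frac1{|G|}\sum_{g\in G} z_1^{c_1}z_2^{c_2}\cdots$, a polynomial in the indeterminates $z=(z_1,z_2,\dots)$ over $\mathbb{Q}$. Let $V_n=\{0,1\}^n\subset\mathbb{R}^n$ be the vertex set of the cube $Q_n$ and $B_n$ the group of signed permutations of $\{1,\dots,n\}$, where $w\in B_n$ with underlying permutation $\pi$ acts on $\mathbb{R}^n$ by $w(x)=y$, $y_i=x_{\pi(i)}$ if $i$ has the sign $+$ and $y_i=1-x_{\pi(i)}$ if $i$ has the sign $-$. Let $Z_n(z)$ be the cycle index of $B_n$ acting on $V_n$. A spanned hyperplane of $Q_n$ is the affine span of $n$ affinely independent vertices of $Q_n$. Let $1\le t\le n$ and let $$H\colon\ a_1x_1+a_2x_2+\cdots+a_tx_t=b$$ be a spanned hyperplane of $Q_n$, where $0<a_1\le a_2\le\cdots\le a_t$ and $b\ge 0$ are integers. Let $F(H)=\{w\in B_n: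 w(H)=H\}$, and let $Z_H(z)$ be the cycle index of $F(H)$ acting on $V_n\cap H$. The type of $H$ is $\alpha=(\alpha_1,\dots,\alpha_\ell)$, where $\ell=a_t$ and $\alpha_i$ is the number of indices $j$ with $a_j=i$. Put $I_i=[\alpha_1+\cdots+\alpha_{i-1}+1,\ \alpha_1+\cdots+\alpha_i]$. Let $S_\alpha$ (resp. $\overline S_\alpha$) be the set of signed permutations $\pi$ of $\{1,\dots,t\}$ all of whose signs are $+$ (resp. $-$) and whose underlying permutation maps each $I_i$ to itself; let $\pi_i$ be the restriction of $\pi$ to $I_i$, and let its cycle type be that of its underlying permutation. Put $\delta(H)=1$ if $\sum_{i=1}^t a_i=2b$ and $\delta(H)=0$ otherwise. Regard the equation of $H$ also as that of a hyperplane in $\mathbb{R}^t$, and let $V_t(H)$ be the set of the vertices of $Q_t$ on it. For a symmetry $\pi$ of $Q_t$ that fixes this hyperplane as a set, and whose cycle type on $V_t(H)$ is $\{1^{m_1},2^{m_2},\dots\}$, let $$f_\pi(z_j)=\prod_{i\ge1}\bigl(z_{\mathrm{lcm}(i,j)}\bigr)^{\frac{ijm_i}{\mathrm{lcm}(i,j)}},\qquad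 f_\pi(z)=(f_\pi(z_1),f_\pi(z_2),\dots).$$ For a tuple $(\mu^1,\dots,\mu^\ell)$ of partitions $\mu^i\vdash\alpha_i$, written $\mu$ for short, let $f_\mu(z)=f_\pi(z)$ for any $\pi\in S_\alpha$ such that $\pi_i$ has cycle type $\mu^i$ for all $i$; if $\delta(H)=1$, let $\overline f_\mu(z)=f_\pi(z)$ for any $\pi\in\overline S_\alpha$ such that $\pi_i$ has cycle type $\mu^i$ for all $i$. For a partition $\lambda=\{1^{m_1},2^{m_2},\dots\}$ let $z_\lambda=1^{m_1}m_1!\,2^{m_2}m_2!\cdots$. **Theorem.** Such symmetries $\pi$ fixing $H$ exist, and $f_\mu(z)$ and, if $\delta(H)=1$, also $\overline f_\mu(z)$ do not depend on the choice of $\pi$. Moreover $$Z_H(z)=\frac{1}{2^{\delta(H)}}\sum_{(\mu^1,\ldots,\mu^\ell)}\ \prod_{i=1}^\ell z_{\mu^i}^{-1}\Bigl(Z_{n-t}(f_\mu(z))+\delta(H)\,Z_{n-t}(\overline f_\mu(z))\Bigr),$$ where the sum is over all tuples with $\mu^i\vdash\alpha_i$ for $1\le i\le\ell$. (If $\delta(H)=0$,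 the term with $\overline f_\mu$ is absent.) -/

import Mathlib

open scoped Pointwise

namespace CubeIndex

/-! ### Cycle types and the cycle index of a finite group action -/

/-- The cycle type of a permutation of a finite set, as the multiset of the lengths of all of its
cycles, the fixed points being cycles of length `1`. -/
noncomputable def fullCycleType {X : Type*} [Fintype X] (g : Equiv.Perm X) : Multiset ℕ :=
  letI := Classical.decEq X
  g.partition.parts

/-- The monomial `z^c = z_1^{c_1} z_2^{c_2} ⋯` of a cycle type `c = {1^{c_1}, 2^{c_2}, …}`. -/
noncomputable def cycleMonomial (c : Multiset ℕ) : MvPolynomial ℕ ℚ :=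
  ∏ i ∈ c.toFinset, MvPolynomial.X i ^ c.count i

/-- The cycle index of a finite group `G` acting on a finite set `X`. The indeterminate `z_i` is
`MvPolynomial.X i`, for `i ≥ 1`; the variable `X 0` never occurs. -/
noncomputable def cycleIndex (G X : Type*) [Group G] [Fintype G] [Fintype X] [MulAction G X] :
    MvPolynomial ℕ ℚ :=
  MvPolynomial.C (1 / (Fintype.card G : ℚ)) *
    ∑ g : G, cycleMonomial (fullCycleType (MulAction.toPerm g : Equiv.Perm X))

/-! ### Signed permutations, the hyperoctahedral group -/

/-- A signed permutation of `n` letters: an underlying permutation and, for each letter `i`, a sign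
(`neg i = true` means that `i` has the sign `-`). -/
@[ext]
structure SignedPerm (n : ℕ) where
  perm : Equiv.Perm (Fin n)
  neg : Fin n → Bool

namespace SignedPerm

variable {n : ℕ}

/-- `w x = y`, where `y_i = x_{π(i)}` if `i` has the sign `+`, and `y_i = 1 - x_{π(i)}` if `i` has
the sign `-`, with `π` the underlying permutation of `w`. -/
instance : SMul (SignedPerm n) (Fin n → ℝ) where
  smul w x := fun i => if w.neg i then 1 - x (w.perm i) else x (w.perm i)

theorem smul_apply (w : SignedPerm n) (x : Fin n → ℝ) (i : Fin n) :
    (w • x) i = if w.neg i then 1 - x (w.perm i) else x (w.perm i) := rfl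

instance : One (SignedPerm n) := ⟨⟨1, fun _ => false⟩⟩

/-- The product is the composition of the symmetries: `(w * w') x = w (w' x)`. -/
instance : Mul (SignedPerm n) :=
  ⟨fun w w' => ⟨w'.perm * w.perm, fun i => xor (w.neg i) (w'.neg (w.perm i))⟩⟩

instance : Inv (SignedPerm n) := ⟨fun w => ⟨w.perm⁻¹, fun i => w.neg (w.perm⁻¹ i)⟩⟩

theorem one_perm : (1 : SignedPerm n).perm = 1 := rfl
theorem one_neg (i : Fin n) : (1 : SignedPerm n).neg i = false := rfl
theorem mul_perm (w w' : SignedPerm n) : (w * w').perm = w'.perm * w.perm := rfl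
theorem mul_neg (w w' : SignedPerm n) (i : Fin n) :
    (w * w').neg i = xor (w.neg i) (w'.neg (w.perm i)) := rfl
theorem inv_perm (w : SignedPerm n) : (w⁻¹).perm = w.perm⁻¹ := rfl
theorem inv_neg (w : SignedPerm n) (i : Fin n) : (w⁻¹).neg i = w.neg (w.perm⁻¹ i) := rfl

instance : Group (SignedPerm n) :=
  Group.ofLeftAxioms
    (fun a b c => by
      ext i
      · simp [mul_perm, mul_assoc]
      · simp [mul_perm, mul_neg])
    (fun a => by
      ext i
      · simp [mul_perm, one_perm]
      · simp [mul_neg, one_perm, one_neg])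
    (fun a => by
      ext i
      · simp [mul_perm, one_perm, inv_perm]
      · simp [mul_neg, one_neg, inv_perm, inv_neg])

instance : MulAction (SignedPerm n) (Fin n → ℝ) where
  one_smul x := by
    funext i
    simp [smul_apply, one_perm, one_neg]
  mul_smul w w' x := by
    funext i
    cases h : w.neg i <;> cases h' : w'.neg (w.perm i) <;>
      simp [smul_apply, mul_perm, mul_neg, h, h']

instance : Fintype (SignedPerm n) :=
  Fintype.ofEquiv (Equiv.Perm (Fin n) × (Fin n → Bool))
    ⟨fun p => ⟨p.1, p.2⟩, fun w => (w.perm, w.neg), fun _ => rfl, fun _ => rfl⟩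

end SignedPerm

/-! ### The vertices of the cube and their symmetries -/

/-- The vertex set `V_n` of the cube `Q_n = [0,1]^n`. -/
def vertices (n : ℕ) : Set (Fin n → ℝ) := {x | ∀ i, x i = 0 ∨ x i = 1}

theorem vertices_finite (n : ℕ) : (vertices n).Finite := by
  have h : (Set.univ.pi fun _ : Fin n => ({0, 1} : Set ℝ)).Finite :=
    Set.Finite.pi fun _ => Set.toFinite _
  refine h.subset fun x hx i _ => ?_
  simpa using hx i

noncomputable instance (n : ℕ) : Fintype (vertices n) := (vertices_finite n).fintype

noncomputable instance (n : ℕ) (H : Set (Fin n → ℝ)) : Fintype ↥(vertices n ∩ H) :=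
  ((vertices_finite n).subset Set.inter_subset_left).fintype

theorem smul_mem_vertices {n : ℕ} (w : SignedPerm n) {x : Fin n → ℝ} (hx : x ∈ vertices n) :
    w • x ∈ vertices n := by
  intro i
  rw [SignedPerm.smul_apply]
  rcases hx (w.perm i) with h | h <;> cases w.neg i <;> simp [h]

/-- The action of the symmetry group of the cube on the vertices. -/
instance (n : ℕ) : MulAction (SignedPerm n) (vertices n) where
  smul w x := ⟨w • x.1, smul_mem_vertices w x.2⟩
  one_smul x := Subtype.ext (one_smul _ x.1)
  mul_smul w w' x := Subtype.ext (mul_smul w w' x.1)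

/-- `Z_n(z)`: the cycle index of the hyperoctahedral group acting on the vertices of the cube. -/
noncomputable def cubeCycleIndex (n : ℕ) : MvPolynomial ℕ ℚ :=
  cycleIndex (SignedPerm n) (vertices n)

/-- `F(H) = {w : w(H) = H}`. -/
def fixer {n : ℕ} (H : Set (Fin n → ℝ)) : Subgroup (SignedPerm n) :=
  MulAction.stabilizer (SignedPerm n) H

noncomputable instance {n : ℕ} (H : Set (Fin n → ℝ)) : Fintype (fixer H) := Fintype.ofFinite _

theorem smul_mem_of_fixer {n : ℕ} {H : Set (Fin n → ℝ)} (w : fixer H) {x : Fin n → ℝ}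
    (hx : x ∈ H) : w.1 • x ∈ H := by
  have h : w.1 • H = H := w.2
  have h' : w.1 • x ∈ w.1 • H := Set.smul_mem_smul_set hx
  rwa [h] at h'

/-- The action of `F(H)` on the set `V_n(H)` of the vertices of the cube that lie in `H`. -/
instance {n : ℕ} (H : Set (Fin n → ℝ)) : MulAction (fixer H) ↥(vertices n ∩ H) where
  smul w x := ⟨w.1 • x.1, smul_mem_vertices w.1 x.2.1, smul_mem_of_fixer w x.2.2⟩
  one_smul x := Subtype.ext (one_smul _ x.1)
  mul_smul w w' x := Subtype.ext (mul_smul w.1 w'.1 x.1)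

/-- `Z_H(z)`: the cycle index of `F(H)` acting on `V_n(H)`. -/
noncomputable def hyperplaneCycleIndex {n : ℕ} (H : Set (Fin n → ℝ)) : MvPolynomial ℕ ℚ :=
  cycleIndex (fixer H) ↥(vertices n ∩ H)

/-! ### Spanned hyperplanes and their types -/

/-- The set `a_1 x_1 + ⋯ + a_t x_t = b` in `ℝ^n`, where `t ≤ n`. -/
def hyperplane {n t : ℕ} (htn : t ≤ n) (a : Fin t → ℕ) (b : ℕ) : Set (Fin n → ℝ) :=
  {x | ∑ i : Fin t, (a i : ℝ) * x (Fin.castLE htn i) = b}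

/-- `H` is the affine span of `n` affinely independent vertices of the cube. -/
def IsSpanned {n : ℕ} (H : Set (Fin n → ℝ)) : Prop :=
  ∃ p : Fin n → (Fin n → ℝ), (∀ i, p i ∈ vertices n) ∧ AffineIndependent ℝ p ∧
    (affineSpan ℝ (Set.range p) : Set (Fin n → ℝ)) = H

/-- The length `ℓ` of the type: the largest coefficient. -/
def typeLength {t : ℕ} (a : Fin t → ℕ) : ℕ := Finset.univ.sup a

/-- The type `α = (α_1, …, α_ℓ)`: the multiplicity of `1, …, ℓ` among the coefficients. The index
`k : Fin ℓ` stands for the value `k + 1`. -/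
def hyperplaneType {t : ℕ} (a : Fin t → ℕ) (k : Fin (typeLength a)) : ℕ :=
  (Finset.univ.filter fun j : Fin t => a j = k.1 + 1).card

/-- The interval `[α_1 + ⋯ + α_{k-1} + 1, α_1 + ⋯ + α_k]`; letters are numbered from `0` here. -/
def block {t l : ℕ} (α : Fin l → ℕ) (k : Fin l) : Finset (Fin t) :=
  Finset.univ.filter fun j =>
    ∑ i ∈ Finset.Iio k, α i ≤ j.1 ∧ j.1 < ∑ i ∈ Finset.Iic k, α i

/-- The Young subgroup `S_α`, inside the signed permutations: all signs are `+`, and each block is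
mapped to itself. -/
def young {t l : ℕ} (α : Fin l → ℕ) : Set (SignedPerm t) :=
  {w | (∀ j, w.neg j = false) ∧ ∀ k j, w.perm j ∈ block α k ↔ j ∈ block α k}

/-- The set `S̄_α`: all signs are `-`, and each block is mapped to itself. -/
def youngBar {t l : ℕ} (α : Fin l → ℕ) : Set (SignedPerm t) :=
  {w | (∀ j, w.neg j = true) ∧ ∀ k j, w.perm j ∈ block α k ↔ j ∈ block α k}

/-- `σ = π_1 ⋯ π_ℓ` where `π_k` is a permutation of the `k`-th block, of cycle type `μ^k`. -/
def HasBlockTypes {t l : ℕ} {α : Fin l → ℕ} (μ : ∀ k, (α k).Partition)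
    (σ : Equiv.Perm (Fin t)) : Prop :=
  ∀ k, ∃ h : ∀ j, σ j ∈ block α k ↔ j ∈ block α k,
    fullCycleType (σ.subtypePerm (p := fun j => j ∈ block α k) h) = (μ k).parts

/-! ### The ingredients of the formula -/

/-- `z_λ = 1^{m_1} m_1! 2^{m_2} m_2! ⋯` for the partition `λ = {1^{m_1}, 2^{m_2}, …}`. -/
def zNumber {m : ℕ} (lam : m.Partition) : ℕ :=
  ∏ i ∈ lam.parts.toFinset, i ^ lam.parts.count i * (lam.parts.count i).factorial

/-- `f(z_j) = ∏_i z_{lcm(i,j)}^{i j m_i / lcm(i,j)}` for the cycle type `{1^{m_1}, 2^{m_2}, …}`. -/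
noncomputable def fOfCycleType (c : Multiset ℕ) (j : ℕ) : MvPolynomial ℕ ℚ :=
  ∏ i ∈ c.toFinset, MvPolynomial.X (Nat.lcm i j) ^ (i * j * c.count i / Nat.lcm i j)

/-- The sequence `f_π(z) = (f_π(z_1), f_π(z_2), …)` of a symmetry `π` that fixes `H`, where
`{1^{m_1}, 2^{m_2}, …}` is the cycle type of `π` on the vertices of the cube lying in `H`. -/
noncomputable def fOf {t : ℕ} {H : Set (Fin t → ℝ)} (π : fixer H) (j : ℕ) : MvPolynomial ℕ ℚ :=
  fOfCycleType (fullCycleType (MulAction.toPerm π : Equiv.Perm ↥(vertices t ∩ H))) j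

/-- `F` is `f_μ(z)`: it is `f_π(z)` for some `π = π_1 ⋯ π_ℓ` in `S_α` with `π_k` of cycle type
`μ^k`; here `a_1 x_1 + ⋯ + a_t x_t = b` is taken as a hyperplane in `ℝ^t`. -/
def IsFmu {t : ℕ} (a : Fin t → ℕ) (b : ℕ) (μ : ∀ k, (hyperplaneType a k).Partition)
    (F : ℕ → MvPolynomial ℕ ℚ) : Prop :=
  ∃ π : fixer (hyperplane (le_refl t) a b),
    π.1 ∈ young (hyperplaneType a) ∧ HasBlockTypes μ π.1.perm ∧ F = fOf π

/-- `F` is `f̄_μ(z)`: it is `f_π(z)` for some `π = π_1 ⋯ π_ℓ` in `S̄_α` with `π_k` of cycle type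
`μ^k`. -/
def IsFmuBar {t : ℕ} (a : Fin t → ℕ) (b : ℕ) (μ : ∀ k, (hyperplaneType a k).Partition)
    (F : ℕ → MvPolynomial ℕ ℚ) : Prop :=
  ∃ π : fixer (hyperplane (le_refl t) a b),
    π.1 ∈ youngBar (hyperplaneType a) ∧ HasBlockTypes μ π.1.perm ∧ F = fOf π

/-- `δ(H) = 1` if `a_1 + ⋯ + a_t = 2 b`, and `δ(H) = 0` otherwise. -/
def delta {t : ℕ} (a : Fin t → ℕ) (b : ℕ) : ℕ := if ∑ i, a i = 2 * b then 1 else 0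

end CubeIndex

open CubeIndex

namespace CubeIndex

/-! A symmetry fixing `H` pulls the defining affine functional back to a multiple of itself.
Permuting and negating coordinates preserves the sum of the absolute values of the coefficients, so
the multiplier is `1` or `-1` (`mem_fixer_setOf_iff`). Hence the symmetry permutes the letters with
equal coefficients, has one common sign on the first `t` letters (the sign `-` being possible
exactly when `δ(H) = 1`), and is arbitrary on the other `n - t`. So `F(H)` is the product of the
corresponding group `F_t` in dimension `t` with `B_{n-t}`, acting on `V_t(H) × V_{n-t}`
(`fixerEquiv`, `verticesEquiv`).

An `i`-cycle and a `j`-cycle together produce `gcd(i,j)` cycles of length `lcm(i,j)`. For fixed `π`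
in `F_t`, averaging over the second factor therefore gives `Z_{n-t}(f_π(z))`
(`cycleMonomial_prodCycleType`, `hyperplaneCycleIndex_eq_sum_fixer`).

What remains is an average over `F_t`, whose order is `2^δ |S_α|`. Elements with the same sign and
the same block cycle types are conjugate in `F_t`, so `f_π` depends only on these data
(`fOf_constSign_eq`), and block types `μ` occur in `S_α` with frequency `∏ z_{μ^k}⁻¹`
(`average_fiberCycleType`). -/

/-! ### Cycle types read off from the periods of points -/

open Function Equiv.Perm in
theorem minimalPeriod_eq_card_support_cycleOf {X : Type*} [Fintype X] [DecidableEq X]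
    (g : Equiv.Perm X) {x : X} (hx : g x ≠ x) :
    minimalPeriod g x = (g.cycleOf x).support.card := by
  -- The periods of `x` are exactly the multiples of its cycle length, which makes the two numbers
  -- divide each other.
  have key : ∀ n, IsPeriodicPt g n x ↔ (g.cycleOf x).support.card ∣ n := by
    intro n
    rw [← (g.isCycleOn_support_cycleOf x).pow_apply_eq (by
      rw [mem_support_cycleOf_iff' hx])]
    rw [IsPeriodicPt, IsFixedPt, Equiv.Perm.iterate_eq_pow]
  apply Nat.dvd_antisymm
  · exact ((key _).2 dvd_rfl).minimalPeriod_dvd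
  · exact (key _).1 (isPeriodicPt_minimalPeriod g x)

open Function Equiv.Perm in
/-- The points of period `k` are those lying on the cycles of length `k`. -/
theorem mul_count_fullCycleType {X : Type*} [Fintype X] [DecidableEq X] (g : Equiv.Perm X)
    (k : ℕ) :
    k * (fullCycleType g).count k =
      (Finset.univ.filter fun x => minimalPeriod g x = k).card := by
  have h0 : fullCycleType g =
      g.cycleType + Multiset.replicate (Fintype.card X - g.support.card) 1 := by
    rw [fullCycleType]
    convert parts_partition (σ := g)
  have hk0 : ∀ x, minimalPeriod g x ≠ 0 := fun x =>
    (minimalPeriod_pos_of_mem_periodicPts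
      (g.injective.mem_periodicPts x)).ne'
  have hfix : ∀ x, minimalPeriod g x = 1 ↔ g x = x := fun x => minimalPeriod_eq_one_iff_isFixedPt
  rw [h0, Multiset.count_add, Multiset.count_replicate]
  -- `cycleType` omits fixed points, so only lengths at least `2` are visible in
  -- `cycleFactorsFinset`; the padding by `1`s handles the rest.
  by_cases hk : 2 ≤ k
  · rw [if_neg (by omega), add_zero]
    have h1 : g.cycleType.count k =
        (g.cycleFactorsFinset.filter fun c => c.support.card = k).card := by
      rw [cycleType_def, Multiset.count_map, ← Finset.filter_val, Finset.card_def]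
      simp only [comp_apply, eq_comm]
    have h2 : (Finset.univ.filter fun x => minimalPeriod g x = k) =
        (g.cycleFactorsFinset.filter fun c => c.support.card = k).biUnion fun c => c.support := by
      ext x
      simp only [Finset.mem_filter, Finset.mem_univ, true_and, Finset.mem_biUnion]
      constructor
      · intro hx
        have hgx : g x ≠ x := fun h => by
          rw [(hfix x).2 h] at hx; omega
        refine ⟨g.cycleOf x, ⟨cycleOf_mem_cycleFactorsFinset_iff.2 (mem_support.2 hgx), ?_⟩, ?_⟩
        · rw [← minimalPeriod_eq_card_support_cycleOf g hgx, hx]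
        · rw [mem_support_cycleOf_iff' hgx]
      · rintro ⟨c, ⟨hc, hck⟩, hxc⟩
        have hgx : g x ≠ x := mem_support.1 (mem_cycleFactorsFinset_support_le hc hxc)
        rw [minimalPeriod_eq_card_support_cycleOf g hgx, ← cycle_is_cycleOf hxc hc, hck]
    rw [h1, h2, Finset.card_biUnion, Finset.sum_congr rfl (g := fun _ => k)]
    · rw [Finset.sum_const, smul_eq_mul, mul_comm]
    · intro c hc
      exact (Finset.mem_filter.1 hc).2
    · intro c hc d hd hcd
      exact (cycleFactorsFinset_pairwise_disjoint g (Finset.mem_filter.1 hc).1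
        (Finset.mem_filter.1 hd).1 hcd).disjoint_support
  · have hc : g.cycleType.count k = 0 :=
      Multiset.count_eq_zero.2 fun h => hk (two_le_of_mem_cycleType h)
    obtain rfl | rfl : k = 0 ∨ k = 1 := by omega
    · simp [hk0]
    · simp only [hc, hfix, if_true, one_mul, zero_add]
      rw [← Finset.card_compl]
      congr 1
      ext x
      simp

theorem fullCycleType_pos {X : Type*} [Fintype X] (g : Equiv.Perm X) {i : ℕ}
    (hi : i ∈ fullCycleType g) : 0 < i := by
  classical
  exact Nat.Partition.parts_pos _ hi

/-- A multiset of positive integers is determined by the numbers `k * count k`. -/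
theorem multiset_eq_of_mul_count {c d : Multiset ℕ} (hc : ∀ i ∈ c, 0 < i) (hd : ∀ i ∈ d, 0 < i)
    (h : ∀ k, k * c.count k = k * d.count k) : c = d := by
  ext k
  rcases Nat.eq_zero_or_pos k with rfl | hk
  · rw [Multiset.count_eq_zero.2 fun h => (hc 0 h).false,
      Multiset.count_eq_zero.2 fun h => (hd 0 h).false]
  · exact Nat.eq_of_mul_eq_mul_left hk (h k)

-- An equivariant bijection preserves minimal periods, and the number of points of each period
-- determines the cycle type.
open Function in
theorem fullCycleType_eq_of_equiv {X Y : Type*} [Fintype X] [Fintype Y] (e : X ≃ Y)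
    {g : Equiv.Perm X} {h : Equiv.Perm Y} (H : ∀ x, e (g x) = h (e x)) :
    fullCycleType g = fullCycleType h := by
  classical
  refine multiset_eq_of_mul_count (fun _ => fullCycleType_pos g) (fun _ => fullCycleType_pos h) ?_
  intro k
  rw [mul_count_fullCycleType, mul_count_fullCycleType]
  have hmp : ∀ x, minimalPeriod h (e x) = minimalPeriod g x := by
    intro x
    have hs : Semiconj e g h := H
    apply Nat.dvd_antisymm
    · exact ((isPeriodicPt_minimalPeriod g x).map hs).minimalPeriod_dvd
    · have := (isPeriodicPt_minimalPeriod h (e x)).map (hs.inverse_left e.left_inv e.right_inv)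
      simpa using this.minimalPeriod_dvd
  refine Finset.card_equiv e fun x => ?_
  simp [hmp]

/-! ### The cycle type of a product of permutations -/

/-- The cycle type of the product of two permutations in terms of theirs. -/
def prodCycleType (c d : Multiset ℕ) : Multiset ℕ :=
  c.bind fun i => d.bind fun j => Multiset.replicate (Nat.gcd i j) (Nat.lcm i j)

/-- A cycle of length `i` consists of `i` points of period `i`. Weighting cycles by their length
thus turns sums over cycles into sums over points, which are easier to handle on a product. -/
theorem sum_map_fullCycleType {X : Type*} [Fintype X] (g : Equiv.Perm X) (φ : ℕ → ℕ) :
    ((fullCycleType g).map fun i => i * φ i).sum = ∑ x, φ (Function.minimalPeriod g x) := by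
  classical
  have hmem : ∀ x, Function.minimalPeriod g x ∈ (fullCycleType g).toFinset := by
    intro x
    rw [Multiset.mem_toFinset, ← Multiset.count_pos]
    refine Nat.pos_of_ne_zero fun h => ?_
    have h1 := mul_count_fullCycleType g (Function.minimalPeriod g x)
    rw [h, mul_zero, eq_comm, Finset.card_eq_zero] at h1
    exact Finset.notMem_empty x (h1 ▸ by simp)
  rw [← Finset.sum_fiberwise_of_maps_to (t := (fullCycleType g).toFinset)
    (g := fun x => Function.minimalPeriod g x) fun x _ => hmem x,
    Finset.sum_multiset_map_count]
  refine Finset.sum_congr rfl fun k _ => ?_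
  rw [Finset.sum_congr rfl (g := fun _ => φ k), Finset.sum_const,
    ← mul_count_fullCycleType, smul_eq_mul, smul_eq_mul]
  · ring
  · intro x hx
    rw [(Finset.mem_filter.1 hx).2]

/-- The period of `(x, y)` is the lcm of the periods of `x` and `y`. The points of period `k` are
then counted on both sides. -/
theorem fullCycleType_prodCongr {X Y : Type*} [Fintype X] [Fintype Y] (g : Equiv.Perm X)
    (h : Equiv.Perm Y) :
    fullCycleType (Equiv.prodCongr g h : Equiv.Perm (X × Y)) =
      prodCycleType (fullCycleType g) (fullCycleType h) := by
  classical
  refine multiset_eq_of_mul_count (fun _ => fullCycleType_pos _) ?_ ?_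
  · intro i hi
    obtain ⟨p, hp, q, hq, h3⟩ : ∃ p ∈ fullCycleType g, ∃ q ∈ fullCycleType h,
        i ∈ Multiset.replicate (Nat.gcd p q) (Nat.lcm p q) := by
      simpa [prodCycleType] using hi
    rw [Multiset.eq_of_mem_replicate h3]
    exact Nat.lcm_pos (fullCycleType_pos g hp) (fullCycleType_pos h hq)
  intro k
  rw [mul_count_fullCycleType]
  -- Since `gcd(i,j) * lcm(i,j) = i * j`, the factor `k` becomes the weights `i` and `j` required by
  -- `sum_map_fullCycleType`.
  have h1 : k * (prodCycleType (fullCycleType g) (fullCycleType h)).count k =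
      ((fullCycleType g).map fun i => i * ((fullCycleType h).map fun j =>
        j * if Nat.lcm i j = k then 1 else 0).sum).sum := by
    rw [prodCycleType, Multiset.count_bind, ← Multiset.sum_map_mul_left]
    congr 1
    refine Multiset.map_congr rfl fun i _ => ?_
    rw [Multiset.count_bind, ← Multiset.sum_map_mul_left, ← Multiset.sum_map_mul_left]
    congr 1
    refine Multiset.map_congr rfl fun j _ => ?_
    rw [Multiset.count_replicate]
    split_ifs with hk
    · rw [← hk, mul_one, mul_comm, Nat.gcd_mul_lcm]
    · simp
  rw [h1, sum_map_fullCycleType g fun i => ((fullCycleType h).map fun j =>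
        j * if Nat.lcm i j = k then 1 else 0).sum]
  simp_rw [sum_map_fullCycleType h fun j => if Nat.lcm _ j = k then 1 else 0]
  rw [Finset.card_filter, Fintype.sum_prod_type]
  refine Finset.sum_congr rfl fun x _ => Finset.sum_congr rfl fun y _ => ?_
  have : Function.minimalPeriod (Equiv.prodCongr g h : Equiv.Perm (X × Y)) (x, y) =
      Nat.lcm (Function.minimalPeriod g x) (Function.minimalPeriod h y) :=
    Function.minimalPeriod_prodMap g h (x, y)
  rw [this]

theorem cycleMonomial_eq_prod_map (c : Multiset ℕ) :
    cycleMonomial c = (c.map fun i => (MvPolynomial.X i : MvPolynomial ℕ ℚ)).prod := by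
  rw [cycleMonomial, Finset.prod_multiset_map_count]

/-- The division in the exponent is exact, because `i * j = gcd(i,j) * lcm(i,j)`; positivity keeps
the divisor nonzero. -/
theorem fOfCycleType_eq_prod_map {c : Multiset ℕ} (hc : ∀ i ∈ c, 0 < i) {j : ℕ} (hj : 0 < j) :
    fOfCycleType c j =
      (c.map fun i => (MvPolynomial.X (Nat.lcm i j) : MvPolynomial ℕ ℚ) ^ Nat.gcd i j).prod := by
  rw [fOfCycleType, Finset.prod_multiset_map_count]
  refine Finset.prod_congr rfl fun i hi => ?_
  rw [← pow_mul, ← Nat.gcd_mul_lcm i j]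
  congr 1
  have hl : 0 < Nat.lcm i j := Nat.lcm_pos (hc i (Multiset.mem_toFinset.1 hi)) hj
  rw [mul_right_comm, Nat.mul_div_cancel _ hl]

/-- This is where the substitution `f_π` comes from: replacing `z_j` by `f(z_j)` records the cycles
that one `j`-cycle forms with all cycles in `c`. -/
theorem cycleMonomial_prodCycleType {c d : Multiset ℕ} (hc : ∀ i ∈ c, 0 < i)
    (hd : ∀ i ∈ d, 0 < i) :
    cycleMonomial (prodCycleType c d) =
      MvPolynomial.bind₁ (fOfCycleType c) (cycleMonomial d) := by
  rw [cycleMonomial_eq_prod_map, cycleMonomial_eq_prod_map, map_multiset_prod, Multiset.map_map]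
  have h1 : (d.map (MvPolynomial.bind₁ (fOfCycleType c) ∘ fun i => MvPolynomial.X i)) =
      d.map fun j => (c.map fun i =>
        (MvPolynomial.X (Nat.lcm i j) : MvPolynomial ℕ ℚ) ^ Nat.gcd i j).prod :=
    Multiset.map_congr rfl fun j hj => by
      rw [Function.comp_apply, MvPolynomial.bind₁_X_right, fOfCycleType_eq_prod_map hc (hd j hj)]
  rw [h1, Multiset.prod_map_prod_map, prodCycleType, Multiset.map_bind, Multiset.prod_bind]
  congr 1
  refine Multiset.map_congr rfl fun i _ => ?_
  rw [Multiset.map_bind, Multiset.prod_bind]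
  congr 1
  refine Multiset.map_congr rfl fun j _ => ?_
  rw [Multiset.map_replicate, Multiset.prod_replicate]

/-! ### Counting and conjugacy of permutations of a given cycle type -/

/-- The number of permutations of cycle type `μ` is `m! / z_μ`. -/
theorem card_fullCycleType_mul_zNumber {X : Type*} [Fintype X] [DecidableEq X] {m : ℕ}
    (hm : Fintype.card X = m) (μ : m.Partition) :
    (Finset.univ.filter fun σ : Equiv.Perm X => fullCycleType σ = μ.parts).card * zNumber μ =
      m.factorial := by
  subst hm
  -- Mathlib's count is stated for `cycleType`, which sees only the parts at least `2`; the parts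
  -- `1` contribute `1 ^ m_1 * m_1!`.
  set c := μ.parts.filter (2 ≤ ·) with hc
  have hparts : μ.parts = c + Multiset.replicate (μ.parts.count 1) 1 := by
    rw [← Multiset.filter_eq', hc]
    conv_lhs => rw [← Multiset.filter_add_not (2 ≤ ·) μ.parts]
    congr 1
    refine Multiset.filter_congr fun i hi => ?_
    have := μ.parts_pos hi
    omega
  have hsum : c.sum + μ.parts.count 1 = Fintype.card X := by
    conv_rhs => rw [← μ.parts_sum, hparts]
    rw [Multiset.sum_add, Multiset.sum_replicate, smul_eq_mul, mul_one]
  have hsub : Fintype.card X - c.sum = μ.parts.count 1 := by omega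
  have hz : zNumber μ = (Fintype.card X - c.sum).factorial * c.prod *
      ∏ n ∈ c.toFinset, (c.count n).factorial := by
    have h1 : (1 : ℕ) ∉ c.toFinset := by simp [hc]
    have h2 : ∀ i ∈ c.toFinset, μ.parts.count i = c.count i := by
      intro i hi
      have : i ≠ 1 := fun h => h1 (h ▸ hi)
      conv_lhs => rw [hparts]
      rw [Multiset.count_add, Multiset.count_replicate, if_neg this.symm, add_zero]
    -- If `1` is not a part, its factor is `1 ^ 0 * 0! = 1`, so it can be inserted in every case.
    have h3 : zNumber μ = ∏ i ∈ insert 1 c.toFinset,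
        i ^ μ.parts.count i * (μ.parts.count i).factorial := by
      rw [zNumber]
      refine Finset.prod_subset ?_ ?_
      · intro i hi
        rw [Multiset.mem_toFinset] at hi
        have := μ.parts_pos hi
        by_cases h : i = 1
        · simp [h]
        · refine Finset.mem_insert_of_mem ?_
          rw [Multiset.mem_toFinset, hc, Multiset.mem_filter]
          exact ⟨hi, by omega⟩
      · intro i _ hi
        rw [Multiset.mem_toFinset, ← Multiset.count_eq_zero] at hi
        simp [hi]
    rw [h3, Finset.prod_insert h1, one_pow, one_mul, hsub, mul_assoc,
      Finset.prod_multiset_count c, ← Finset.prod_mul_distrib]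
    congr 1
    refine Finset.prod_congr rfl fun i hi => ?_
    rw [h2 i hi]
  have hset : (Finset.univ.filter fun σ : Equiv.Perm X => fullCycleType σ = μ.parts) =
      Finset.univ.filter fun σ : Equiv.Perm X => σ.cycleType = c := by
    ext σ
    have h0 : fullCycleType σ =
        σ.cycleType + Multiset.replicate (Fintype.card X - σ.support.card) 1 := by
      rw [fullCycleType]
      convert Equiv.Perm.parts_partition (σ := σ)
    simp only [Finset.mem_filter, Finset.mem_univ, true_and]
    constructor
    · intro h
      rw [hc, ← h, ← Equiv.Perm.filter_parts_partition_eq_cycleType, h0]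
      rfl
    · intro h
      rw [h0, hparts, ← Equiv.Perm.sum_cycleType, h, hsub]
  rw [hset, hz, Equiv.Perm.card_of_cycleType_mul_eq, if_pos]
  refine ⟨by omega, fun i hi => ?_⟩
  rw [hc, Multiset.mem_filter] at hi
  exact hi.2

theorem isConj_of_fullCycleType_eq {X : Type*} [Fintype X] {σ τ : Equiv.Perm X}
    (h : fullCycleType σ = fullCycleType τ) : IsConj σ τ := by
  classical
  rw [Equiv.Perm.partition_eq_of_isConj, Nat.Partition.ext_iff]
  unfold fullCycleType at h
  convert h

/-! ### Symmetries of the cube fixing a hyperplane -/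

/-- Affine functionals with the same zero set have proportional linear parts. -/
theorem exists_smul_of_hyperplane_eq {n : ℕ} {A B : Fin n → ℝ} {b N : ℝ} (hA : ∃ j, A j ≠ 0)
    (h : ∀ x : Fin n → ℝ, ∑ i, A i * x i = b → ∑ i, B i * x i + N = b) :
    ∃ c : ℝ, (∀ i, B i = c * A i) ∧ c * b + N = b := by
  obtain ⟨j, hj⟩ := hA
  -- The test points are supported on coordinates `j` and `i`. Adding the two `Pi.single`s, rather
  -- than updating, keeps the formula valid for `i = j`.
  have hsum : ∀ (C : Fin n → ℝ) (i : Fin n) (s r : ℝ),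
      ∑ k, C k * (Pi.single j s + Pi.single i r : Fin n → ℝ) k = C j * s + C i * r := by
    intro C i s r
    simp [mul_add, Finset.sum_add_distrib, Pi.single_apply]
  -- The value at `j` is chosen to put the point on the first hyperplane. Comparing `s = 1` with `s
  -- = 0` then isolates `B i`.
  have h1 : ∀ i s, B j * ((b - A i * s) / A j) + B i * s + N = b := by
    intro i s
    rw [← hsum]
    apply h
    rw [hsum, mul_div_cancel₀ _ hj]
    ring
  refine ⟨B j / A j, fun i => ?_, ?_⟩
  · have h2 := h1 i 1
    have h3 := h1 i 0
    field_simp at h2 h3 ⊢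
    linarith
  · have h3 := h1 j 0
    field_simp at h3 ⊢
    linarith

/-- The symmetries of the cube that fix a hyperplane with coefficients in `ℕ`. -/
theorem mem_fixer_setOf_iff {n : ℕ} {A : Fin n → ℕ} {b : ℕ} (hA : ∃ j, 0 < A j)
    (w : SignedPerm n) :
    w ∈ fixer {x : Fin n → ℝ | ∑ i, (A i : ℝ) * x i = b} ↔
      (∀ i, A (w.perm i) = A i) ∧ ((∀ i, 0 < A i → w.neg i = false) ∨
        (∀ i, 0 < A i → w.neg i = true) ∧ ∑ i, A i = 2 * b) := by
  rw [fixer, MulAction.mem_stabilizer_set]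
  simp only [Set.mem_ofPred_eq]
  constructor
  · intro h
    -- A letter with sign `-` contributes `A i * (1 - x)`: its coefficient changes sign and `A i`
    -- goes into the constant `N`.
    set ε : Fin n → ℝ := fun i => if w.neg i then -1 else 1 with hε
    set N : ℝ := ∑ i, if w.neg i then (A i : ℝ) else 0 with hN
    have key : ∀ x : Fin n → ℝ, ∑ i, (A i : ℝ) * (w • x) i =
        ∑ i, (ε (w.perm⁻¹ i) * A (w.perm⁻¹ i)) * x i + N := by
      intro x
      rw [← Equiv.sum_comp w.perm (fun i => (ε (w.perm⁻¹ i) * A (w.perm⁻¹ i)) * x i), hN,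
        ← Finset.sum_add_distrib]
      refine Finset.sum_congr rfl fun i _ => ?_
      rw [SignedPerm.smul_apply]
      simp only [hε, Equiv.Perm.coe_inv, Equiv.symm_apply_apply]
      split_ifs <;> ring
    obtain ⟨c, hc, hcb⟩ := exists_smul_of_hyperplane_eq (A := fun i => (A i : ℝ))
      (B := fun i => ε (w.perm⁻¹ i) * A (w.perm⁻¹ i)) (b := b) (N := N)
      (by obtain ⟨j, hj⟩ := hA; exact ⟨j, by exact_mod_cast hj.ne'⟩)
      (fun x hx => by rw [← key]; exact (h x).2 hx)
    have hc' : ∀ i, ε i * A i = c * A (w.perm i) := fun i => by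
      simpa using hc (w.perm i)
    have habs : ∀ i, (A i : ℝ) = |c| * A (w.perm i) := by
      intro i
      have h1 := congrArg abs (hc' i)
      rw [abs_mul, abs_mul, Nat.abs_cast, Nat.abs_cast] at h1
      rw [← h1]
      simp only [hε]
      split_ifs <;> simp
    have hS : (0 : ℝ) < ∑ i, (A i : ℝ) := by
      obtain ⟨j, hj⟩ := hA
      exact Finset.sum_pos' (fun i _ => by positivity) ⟨j, Finset.mem_univ j, by exact_mod_cast hj⟩
    -- Summing `habs` over all letters gives the same positive total on both sides, as `w.perm` only
    -- rearranges it.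
    have hc1 : |c| = 1 := by
      have h1 : ∑ i, (A i : ℝ) = |c| * ∑ i, (A i : ℝ) := by
        conv_lhs => rw [Finset.sum_congr rfl fun i _ => habs i]
        rw [← Finset.mul_sum, Equiv.sum_comp w.perm fun i => (A i : ℝ)]
      nlinarith
    have hperm : ∀ i, A (w.perm i) = A i := fun i => by
      have := habs i
      rw [hc1, one_mul] at this
      exact_mod_cast this.symm
    refine ⟨hperm, ?_⟩
    have hcases : ∀ i, 0 < A i → ε i = c := by
      intro i hi
      have h1 := hc' i
      rw [hperm] at h1
      exact mul_right_cancel₀ (by exact_mod_cast hi.ne') h1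
    rcases eq_or_eq_neg_of_abs_eq hc1 with rfl | rfl
    · left
      intro i hi
      have h1 := hcases i hi
      by_contra h2
      rw [Bool.not_eq_false] at h2
      simp only [hε, h2, if_true] at h1
      norm_num at h1
    · right
      have hneg : ∀ i, 0 < A i → w.neg i = true := by
        intro i hi
        have h1 := hcases i hi
        by_contra h2
        rw [Bool.not_eq_true] at h2
        simp only [hε, h2] at h1
        norm_num at h1
      refine ⟨hneg, ?_⟩
      -- With `c = -1`, `hcb` reads `-b + N = b`, so the value of `N` yields the condition on `b`.
      have h3 : N = ∑ i, (A i : ℝ) := by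
        refine Finset.sum_congr rfl fun i _ => ?_
        rcases Nat.eq_zero_or_pos (A i) with h0 | h0
        · simp [h0]
        · simp [hneg i h0]
      have h4 : (∑ i, (A i : ℝ)) = 2 * b := by linarith
      exact_mod_cast h4
  · rintro ⟨hperm, hneg | ⟨hneg, hb⟩⟩ x
    · have : ∑ i, (A i : ℝ) * (w • x) i = ∑ i, (A i : ℝ) * x i := by
        rw [← Equiv.sum_comp w.perm fun i => (A i : ℝ) * x i]
        refine Finset.sum_congr rfl fun i _ => ?_
        rw [hperm, SignedPerm.smul_apply]
        rcases Nat.eq_zero_or_pos (A i) with h0 | h0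
        · simp [h0]
        · simp [hneg i h0]
      rw [this]
    · have hb' : ∑ i, (A i : ℝ) = 2 * b := by exact_mod_cast hb
      have : ∑ i, (A i : ℝ) * (w • x) i = 2 * b - ∑ i, (A i : ℝ) * x i := by
        rw [← Equiv.sum_comp w.perm fun i => (A i : ℝ) * x i, ← hb', ← Finset.sum_sub_distrib]
        refine Finset.sum_congr rfl fun i _ => ?_
        rw [hperm, SignedPerm.smul_apply]
        rcases Nat.eq_zero_or_pos (A i) with h0 | h0
        · simp [h0]
        · rw [hneg i h0, if_pos rfl]
          ring
      rw [this]
      constructor <;> intro h <;> linarith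

theorem mem_fixer_hyperplane_iff {t : ℕ} (ht : 0 < t) {a : Fin t → ℕ} {b : ℕ}
    (ha : ∀ i, 0 < a i) (w : SignedPerm t) :
    w ∈ fixer (hyperplane (le_refl t) a b) ↔
      (∀ i, a (w.perm i) = a i) ∧ ((∀ i, w.neg i = false) ∨
        (∀ i, w.neg i = true) ∧ ∑ i, a i = 2 * b) := by
  have := mem_fixer_setOf_iff (A := a) (b := b) ⟨⟨0, ht⟩, ha _⟩ w
  simp only [ha, forall_const] at this
  exact this

/-! ### Splitting off the coordinates absent from the equation -/

/-- The symmetry of the cube of dimension `t + m` built from symmetries of two complementary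
faces. -/
def SignedPerm.glue {t m : ℕ} (p : SignedPerm t × SignedPerm m) : SignedPerm (t + m) where
  perm := finSumFinEquiv.permCongr (Equiv.sumCongr p.1.perm p.2.perm)
  neg := Fin.append p.1.neg p.2.neg

theorem SignedPerm.glue_perm_castAdd {t m : ℕ} (p : SignedPerm t × SignedPerm m) (i : Fin t) :
    (glue p).perm (Fin.castAdd m i) = Fin.castAdd m (p.1.perm i) := by
  simp [glue, Equiv.permCongr_apply]

theorem SignedPerm.glue_perm_natAdd {t m : ℕ} (p : SignedPerm t × SignedPerm m) (i : Fin m) :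
    (glue p).perm (Fin.natAdd t i) = Fin.natAdd t (p.2.perm i) := by
  simp [glue, Equiv.permCongr_apply]

theorem SignedPerm.glue_smul_append {t m : ℕ} (p : SignedPerm t × SignedPerm m)
    (x : Fin t → ℝ) (y : Fin m → ℝ) :
    glue p • Fin.append x y = Fin.append (p.1 • x) (p.2 • y) := by
  funext i
  refine Fin.addCases (fun i => ?_) (fun i => ?_) i
  · rw [smul_apply, glue_perm_castAdd, Fin.append_left, Fin.append_left, smul_apply]
    simp [glue]
  · rw [smul_apply, glue_perm_natAdd, Fin.append_right, Fin.append_right, smul_apply]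
    simp [glue]

theorem SignedPerm.glue_injective {t m : ℕ} :
    Function.Injective (glue : SignedPerm t × SignedPerm m → SignedPerm (t + m)) := by
  rintro ⟨σ, v⟩ ⟨σ', v'⟩ h
  have hp : ∀ i, (glue (σ, v)).perm i = (glue (σ', v')).perm i := fun i => by rw [h]
  have hn : ∀ i, (glue (σ, v)).neg i = (glue (σ', v')).neg i := fun i => by rw [h]
  refine Prod.ext (SignedPerm.ext (Equiv.ext fun i => ?_) (funext fun i => ?_))
    (SignedPerm.ext (Equiv.ext fun i => ?_) (funext fun i => ?_))
  · have := hp (Fin.castAdd m i)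
    rw [glue_perm_castAdd, glue_perm_castAdd] at this
    exact Fin.castAdd_injective t m this
  · simpa [glue] using hn (Fin.castAdd m i)
  · have := hp (Fin.natAdd t i)
    rw [glue_perm_natAdd, glue_perm_natAdd] at this
    exact Fin.natAdd_injective m t this
  · simpa [glue] using hn (Fin.natAdd t i)

/-- By finiteness, a permutation mapping the first `t` letters into themselves also preserves the
complement. -/
theorem SignedPerm.exists_glue_eq {t m : ℕ} (w : SignedPerm (t + m))
    (hw : ∀ i : Fin t, ∃ j : Fin t, w.perm (Fin.castAdd m i) = Fin.castAdd m j) :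
    ∃ p : SignedPerm t × SignedPerm m, glue p = w := by
  have hmaps : Set.MapsTo (finSumFinEquiv.symm.permCongr w.perm)
      (Set.range (Sum.inl : Fin t → Fin t ⊕ Fin m)) (Set.range Sum.inl) := by
    rintro _ ⟨i, rfl⟩
    obtain ⟨j, hj⟩ := hw i
    exact ⟨j, by simp [Equiv.permCongr_apply, hj]⟩
  obtain ⟨⟨σ, τ⟩, hστ⟩ := Equiv.Perm.mem_sumCongrHom_range_of_perm_mapsTo_inl hmaps
  refine ⟨(⟨σ, fun i => w.neg (Fin.castAdd m i)⟩, ⟨τ, fun i => w.neg (Fin.natAdd t i)⟩), ?_⟩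
  refine SignedPerm.ext ?_ ?_
  · have : Equiv.sumCongr σ τ = finSumFinEquiv.symm.permCongr w.perm := hστ
    rw [glue, this]
    ext i
    simp [Equiv.permCongr_apply]
  · funext i
    refine Fin.addCases (fun i => ?_) (fun i => ?_) i <;> simp [glue]

theorem append_mem_hyperplane_iff {t m : ℕ} (h : t ≤ t + m) (a : Fin t → ℕ) (b : ℕ)
    (x : Fin t → ℝ) (y : Fin m → ℝ) :
    Fin.append x y ∈ hyperplane h a b ↔ x ∈ hyperplane (le_refl t) a b := by
  have h1 : ∀ i : Fin t, Fin.append x y (Fin.castLE h i) = x i := fun i => Fin.append_left x y i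
  simp only [hyperplane, Set.mem_ofPred_eq, h1]
  rfl

theorem append_mem_vertices_iff {t m : ℕ} (x : Fin t → ℝ) (y : Fin m → ℝ) :
    Fin.append x y ∈ vertices (t + m) ↔ x ∈ vertices t ∧ y ∈ vertices m := by
  constructor
  · intro h
    exact ⟨fun i => by simpa using h (Fin.castAdd m i), fun i => by simpa using h (Fin.natAdd t i)⟩
  · rintro ⟨hx, hy⟩ i
    refine Fin.addCases (fun i => ?_) (fun i => ?_) i
    · simpa using hx i
    · simpa using hy i

theorem glue_mem_fixer_iff {t m : ℕ} (h : t ≤ t + m) (a : Fin t → ℕ) (b : ℕ)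
    (p : SignedPerm t × SignedPerm m) :
    SignedPerm.glue p ∈ fixer (hyperplane h a b) ↔ p.1 ∈ fixer (hyperplane (le_refl t) a b) := by
  rw [fixer, fixer, MulAction.mem_stabilizer_set, MulAction.mem_stabilizer_set]
  constructor
  · intro H x
    have := H (Fin.append x 0)
    rwa [SignedPerm.glue_smul_append, append_mem_hyperplane_iff, append_mem_hyperplane_iff] at this
  · intro H z
    obtain ⟨⟨x, y⟩, rfl⟩ := (Fin.appendEquiv t m).surjective z
    change _ • Fin.append x y ∈ _ ↔ Fin.append x y ∈ _
    rw [SignedPerm.glue_smul_append, append_mem_hyperplane_iff, append_mem_hyperplane_iff, H]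

theorem exists_glue_eq_of_mem_fixer {t m : ℕ} (ht : 0 < t) (h : t ≤ t + m) {a : Fin t → ℕ}
    {b : ℕ} (ha : ∀ i, 0 < a i) {w : SignedPerm (t + m)} (hw : w ∈ fixer (hyperplane h a b)) :
    ∃ p : SignedPerm t × SignedPerm m, SignedPerm.glue p = w := by
  -- With the coefficients extended by `0`, a fixing symmetry preserves coefficients, so it cannot
  -- send a letter with positive coefficient to one of the last `m`.
  set A : Fin (t + m) → ℕ := Fin.append a 0 with hA
  have hset : hyperplane h a b = {x : Fin (t + m) → ℝ | ∑ i, (A i : ℝ) * x i = b} := by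
    ext x
    simp only [hyperplane, Set.mem_ofPred_eq, Fin.sum_univ_add, hA, Fin.append_left,
      Fin.append_right, Pi.zero_apply, Nat.cast_zero, zero_mul, Finset.sum_const_zero, add_zero]
    rfl
  rw [hset, mem_fixer_setOf_iff ⟨Fin.castAdd m ⟨0, ht⟩, by rw [hA, Fin.append_left]; exact ha _⟩] at hw
  refine SignedPerm.exists_glue_eq w fun i => ?_
  have h1 := hw.1 (Fin.castAdd m i)
  generalize w.perm (Fin.castAdd m i) = j at h1
  revert h1
  refine Fin.addCases (fun j => ?_) (fun j => ?_) j
  · exact fun _ => ⟨j, rfl⟩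
  · intro h1
    simp only [hA, Fin.append_left, Fin.append_right, Pi.zero_apply] at h1
    exact absurd (ha i) (by omega)

/-- The symmetries fixing a hyperplane in which only the first `t` coordinates occur. -/
noncomputable def fixerEquiv {t m : ℕ} (ht : 0 < t) (h : t ≤ t + m) {a : Fin t → ℕ} (b : ℕ)
    (ha : ∀ i, 0 < a i) :
    fixer (hyperplane (le_refl t) a b) × SignedPerm m ≃ fixer (hyperplane h a b) :=
  Equiv.ofBijective (fun p => ⟨SignedPerm.glue (p.1.1, p.2),
      (glue_mem_fixer_iff h a b (p.1.1, p.2)).2 p.1.2⟩) <| by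
    constructor
    · rintro ⟨σ, v⟩ ⟨σ', v'⟩ hp
      have := SignedPerm.glue_injective (congrArg Subtype.val hp)
      rw [Prod.mk.injEq] at this
      exact Prod.ext (Subtype.ext this.1) this.2
    · rintro ⟨w, hw⟩
      obtain ⟨p, rfl⟩ := exists_glue_eq_of_mem_fixer ht h ha hw
      exact ⟨(⟨p.1, (glue_mem_fixer_iff h a b p).1 hw⟩, p.2), rfl⟩

/-- The vertices on a hyperplane in which only the first `t` coordinates occur. -/
def verticesEquiv {t m : ℕ} (h : t ≤ t + m) (a : Fin t → ℕ) (b : ℕ) :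
    ↥(vertices t ∩ hyperplane (le_refl t) a b) × vertices m ≃
      ↥(vertices (t + m) ∩ hyperplane h a b) where
  toFun p := ⟨Fin.append p.1.1 p.2.1, (append_mem_vertices_iff _ _).2 ⟨p.1.2.1, p.2.2⟩,
    (append_mem_hyperplane_iff h a b _ _).2 p.1.2.2⟩
  invFun z := (⟨fun i => z.1 (Fin.castAdd m i), fun i => z.2.1 _, z.2.2⟩,
    ⟨fun i => z.1 (Fin.natAdd t i), fun i => z.2.1 _⟩)
  left_inv p := by
    refine Prod.ext (Subtype.ext (funext fun i => ?_)) (Subtype.ext (funext fun i => ?_)) <;> simp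
  right_inv z := by
    refine Subtype.ext (funext fun i => ?_)
    refine Fin.addCases (fun i => ?_) (fun i => ?_) i <;> simp

theorem cycleMonomial_fixerEquiv {t m : ℕ} (ht : 0 < t) (h : t ≤ t + m) {a : Fin t → ℕ} (b : ℕ)
    (ha : ∀ i, 0 < a i) (π : fixer (hyperplane (le_refl t) a b)) (v : SignedPerm m) :
    cycleMonomial (fullCycleType (MulAction.toPerm (fixerEquiv ht h b ha (π, v)) :
        Equiv.Perm ↥(vertices (t + m) ∩ hyperplane h a b))) =
      MvPolynomial.bind₁ (fOf π)
        (cycleMonomial (fullCycleType (MulAction.toPerm v : Equiv.Perm (vertices m)))) := by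
  rw [← fullCycleType_eq_of_equiv (verticesEquiv h a b) (g := Equiv.prodCongr
      (MulAction.toPerm π) (MulAction.toPerm v)), fullCycleType_prodCongr,
    cycleMonomial_prodCycleType (fun _ => fullCycleType_pos _) (fun _ => fullCycleType_pos _)]
  · rfl
  · rintro ⟨x, y⟩
    exact Subtype.ext (SignedPerm.glue_smul_append (π.1, v) x.1 y.1).symm

/-- Substitution is an algebra homomorphism, so it commutes with the average over the second factor
of `fixerEquiv`, which is a cube's cycle index. -/
theorem hyperplaneCycleIndex_eq_sum_fixer {t m : ℕ} (ht : 0 < t) (h : t ≤ t + m) {a : Fin t → ℕ}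
    (b : ℕ) (ha : ∀ i, 0 < a i) :
    hyperplaneCycleIndex (hyperplane h a b) =
      MvPolynomial.C (1 / (Fintype.card (fixer (hyperplane (le_refl t) a b)) : ℚ)) *
        ∑ π : fixer (hyperplane (le_refl t) a b),
          MvPolynomial.bind₁ (fOf π) (cubeCycleIndex m) := by
  rw [hyperplaneCycleIndex, cycleIndex, ← Fintype.card_congr (fixerEquiv ht h b ha),
    ← Equiv.sum_comp (fixerEquiv ht h b ha), Fintype.sum_prod_type, Fintype.card_prod]
  simp only [cycleMonomial_fixerEquiv, cubeCycleIndex, cycleIndex, map_mul, map_sum,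
    MvPolynomial.algHom_C]
  rw [← Finset.mul_sum, ← mul_assoc]
  congr 1
  rw [MvPolynomial.algebraMap_eq, ← MvPolynomial.C_mul]
  congr 1
  push_cast
  rw [div_mul_div_comm, one_mul]

/-! ### Permutations preserving the fibres of a map -/

/-- The permutations preserving the fibres of `p` are families of permutations of the fibres. -/
def fiberPermEquiv {J K : Type*} (p : J → K) :
    {σ : Equiv.Perm J // ∀ j, p (σ j) = p j} ≃ ∀ k, Equiv.Perm {j // p j = k} where
  toFun σ k := σ.1.subtypePerm (p := fun j => p j = k) fun j => by rw [σ.2 j]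
  invFun f := ⟨(Equiv.sigmaFiberEquiv p).permCongr (Equiv.sigmaCongrRight f),
    fun j => (f (p j) ⟨j, rfl⟩).2⟩
  left_inv _ := rfl
  right_inv f := by
    funext k
    ext ⟨j, rfl⟩
    rfl

theorem fiberPermEquiv_symm_apply {J K : Type*} (p : J → K)
    (f : ∀ k, Equiv.Perm {j // p j = k}) {j : J} {k : K} (h : p j = k) :
    ((fiberPermEquiv p).symm f).1 j = (f k ⟨j, h⟩).1 := by
  subst h
  rfl

/-- The permutations preserving the fibres of `p`, with the given cycle types on the fibres. -/
noncomputable def fiberCycleType {J K : Type*} [Fintype J] [DecidableEq K] {p : J → K}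
    {α : K → ℕ} (hα : ∀ k, Fintype.card {j // p j = k} = α k)
    (σ : {σ : Equiv.Perm J // ∀ j, p (σ j) = p j}) (k : K) : (α k).Partition where
  parts := fullCycleType (fiberPermEquiv p σ k)
  parts_pos h := fullCycleType_pos _ h
  parts_sum := by
    classical
    exact (Nat.Partition.parts_sum _).trans (hα k)

theorem fiberCycleType_eq_iff {J K : Type*} [Fintype J] [DecidableEq K] {p : J → K}
    {α : K → ℕ} (hα : ∀ k, Fintype.card {j // p j = k} = α k)
    (σ : {σ : Equiv.Perm J // ∀ j, p (σ j) = p j}) (μ : ∀ k, (α k).Partition) :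
    fiberCycleType hα σ = μ ↔ ∀ k, fullCycleType (fiberPermEquiv p σ k) = (μ k).parts := by
  rw [funext_iff]
  exact forall_congr' fun k => Nat.Partition.ext_iff

/-- The choices on different fibres are independent, and on each fibre the count times `z_{μ^k}` is
`α_k!`. -/
theorem card_filter_fiberCycleType {J K : Type*} [Fintype J] [DecidableEq J] [Fintype K]
    [DecidableEq K] {p : J → K} {α : K → ℕ} (hα : ∀ k, Fintype.card {j // p j = k} = α k)
    (μ : ∀ k, (α k).Partition) :
    (Finset.univ.filter fun σ => fiberCycleType hα σ = μ).card * ∏ k, zNumber (μ k) =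
      Fintype.card {σ : Equiv.Perm J // ∀ j, p (σ j) = p j} := by
  have h1 : (Finset.univ.filter fun σ => fiberCycleType hα σ = μ).card =
      (Fintype.piFinset fun k => Finset.univ.filter fun σ : Equiv.Perm {j // p j = k} =>
        fullCycleType σ = (μ k).parts).card := by
    refine Finset.card_equiv (fiberPermEquiv p) fun σ => ?_
    simp [fiberCycleType_eq_iff]
  rw [h1, Fintype.card_piFinset, ← Finset.prod_mul_distrib,
    Fintype.card_congr (fiberPermEquiv p), Fintype.card_pi]
  refine Finset.prod_congr rfl fun k _ => ?_
  rw [card_fullCycleType_mul_zNumber (hα k), Fintype.card_perm, hα]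

/-- The counting formula has a nonzero right side, so the count cannot vanish. -/
theorem exists_fiberCycleType_eq {J K : Type*} [Fintype J] [DecidableEq J] [Fintype K]
    [DecidableEq K] {p : J → K} {α : K → ℕ} (hα : ∀ k, Fintype.card {j // p j = k} = α k)
    (μ : ∀ k, (α k).Partition) : ∃ σ, fiberCycleType hα σ = μ := by
  have h := card_filter_fiberCycleType hα μ
  have h0 : 0 < Fintype.card {σ : Equiv.Perm J // ∀ j, p (σ j) = p j} :=
    Fintype.card_pos_iff.2 ⟨⟨1, fun _ => rfl⟩⟩
  rw [← h] at h0
  obtain ⟨σ, hσ⟩ := Finset.card_pos.1 (Nat.pos_of_mul_pos_right h0)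
  exact ⟨σ, (Finset.mem_filter.1 hσ).2⟩

/-- Averaging a function of the cycle types over the permutations preserving the fibres. -/
theorem average_fiberCycleType {J K R : Type*} [Fintype J] [DecidableEq J] [Fintype K]
    [DecidableEq K] [CommRing R] [Algebra ℚ R] {p : J → K} {α : K → ℕ}
    (hα : ∀ k, Fintype.card {j // p j = k} = α k) (g : (∀ k, (α k).Partition) → R) :
    algebraMap ℚ R (1 / (Fintype.card {σ : Equiv.Perm J // ∀ j, p (σ j) = p j} : ℚ)) *
        ∑ σ, g (fiberCycleType hα σ) =
      ∑ μ, algebraMap ℚ R (∏ k, ((zNumber (μ k) : ℚ))⁻¹) * g μ := by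
  rw [← Finset.sum_fiberwise Finset.univ (fiberCycleType hα), Finset.mul_sum]
  refine Finset.sum_congr rfl fun μ _ => ?_
  rw [Finset.sum_congr rfl (g := fun _ => g μ) fun σ hσ => by rw [(Finset.mem_filter.1 hσ).2],
    Finset.sum_const, nsmul_eq_mul, ← mul_assoc, ← map_natCast (algebraMap ℚ R), ← map_mul]
  congr 2
  have h := card_filter_fiberCycleType hα μ
  have h0 : 0 < Fintype.card {σ : Equiv.Perm J // ∀ j, p (σ j) = p j} :=
    Fintype.card_pos_iff.2 ⟨⟨1, fun _ => rfl⟩⟩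
  rw [← h] at h0 ⊢
  have h1 := (Nat.pos_of_mul_pos_left h0).ne'
  have h2 := (Nat.pos_of_mul_pos_right h0).ne'
  rw [Finset.prod_inv_distrib]
  push_cast at h1 h2 ⊢
  have h1' : (∏ k, (zNumber (μ k) : ℚ)) ≠ 0 := by exact_mod_cast h1
  have h2' : ((Finset.univ.filter fun σ => fiberCycleType hα σ = μ).card : ℚ) ≠ 0 := by
    exact_mod_cast h2
  field_simp

/-- Conjugators are chosen separately on each fibre and assembled, so the resulting conjugator again
preserves the fibres. -/
theorem exists_conj_of_fiberCycleType_eq {J K : Type*} [Fintype J] [DecidableEq K] {p : J → K}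
    {α : K → ℕ} (hα : ∀ k, Fintype.card {j // p j = k} = α k)
    {σ τ : {σ : Equiv.Perm J // ∀ j, p (σ j) = p j}}
    (h : fiberCycleType hα σ = fiberCycleType hα τ) :
    ∃ c : {σ : Equiv.Perm J // ∀ j, p (σ j) = p j}, c.1 * σ.1 = τ.1 * c.1 := by
  have hk : ∀ k, ∃ c : Equiv.Perm {j // p j = k},
      c * fiberPermEquiv p σ k = fiberPermEquiv p τ k * c := fun k => by
    obtain ⟨c, hc⟩ := isConj_iff.1
      (isConj_of_fullCycleType_eq ((fiberCycleType_eq_iff hα σ _).1 h k))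
    exact ⟨c, by rw [← hc, inv_mul_cancel_right]⟩
  choose c hc using hk
  refine ⟨(fiberPermEquiv p).symm c, ?_⟩
  ext j
  rw [Equiv.Perm.mul_apply, Equiv.Perm.mul_apply, fiberPermEquiv_symm_apply p c (σ.2 j),
    fiberPermEquiv_symm_apply p c rfl]
  exact congrArg Subtype.val (Equiv.congr_fun (hc (p j)) ⟨j, rfl⟩)

/-! ### Blocks of the type as fibres of the coefficients -/

/-- A downward closed subset of `Fin t` is the initial segment of its own cardinality. -/
theorem val_lt_card_filter_iff {t : ℕ} (q : Fin t → Prop) [DecidablePred q]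
    (hq : ∀ i j, i ≤ j → q j → q i) (j : Fin t) :
    j.1 < (Finset.univ.filter q).card ↔ q j := by
  constructor
  · intro h
    by_contra hj
    have : Finset.univ.filter q ⊆ Finset.Iio j := by
      intro i hi
      rw [Finset.mem_Iio]
      by_contra hij
      exact hj (hq j i (not_lt.1 hij) (Finset.mem_filter.1 hi).2)
    have := Finset.card_le_card this
    rw [Fin.card_Iio] at this
    omega
  · intro hj
    have : Finset.Iic j ⊆ Finset.univ.filter q := fun i hi =>
      Finset.mem_filter.2 ⟨Finset.mem_univ i, hq i j (Finset.mem_Iic.1 hi) hj⟩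
    have := Finset.card_le_card this
    rw [Fin.card_Iic] at this
    omega

/-- The blocks of the fibre sizes of a monotone map are its fibres. -/
theorem mem_block_iff_of_monotone {t l : ℕ} {p : Fin t → Fin l} (hp : Monotone p)
    {α : Fin l → ℕ} (hα : ∀ k, Fintype.card {j // p j = k} = α k) (k : Fin l) (j : Fin t) :
    j ∈ block α k ↔ p j = k := by
  -- Partial sums of `α` count letters whose index lies in an initial segment, so the two bounds
  -- defining a block become `k ≤ p j` and `p j ≤ k`.
  have hsum : ∀ s : Finset (Fin l),
      ∑ i ∈ s, α i = (Finset.univ.filter fun j => p j ∈ s).card := by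
    intro s
    rw [Finset.card_eq_sum_card_fiberwise (f := p) (t := s) fun j hj => by simpa using hj]
    refine Finset.sum_congr rfl fun i hi => ?_
    rw [← hα, Fintype.card_subtype, Finset.filter_filter]
    congr 1
    refine Finset.filter_congr fun j _ => ?_
    constructor
    · rintro rfl
      exact ⟨hi, rfl⟩
    · exact And.right
  rw [block, Finset.mem_filter, hsum, hsum, ← not_lt,
    val_lt_card_filter_iff _ (fun i j hij h => Finset.mem_Iio.2
      ((hp hij).trans_lt (Finset.mem_Iio.1 h))),
    val_lt_card_filter_iff _ (fun i j hij h => Finset.mem_Iic.2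
      ((hp hij).trans (Finset.mem_Iic.1 h))),
    Finset.mem_Iio, Finset.mem_Iic, not_lt]
  exact ⟨fun h => le_antisymm h.2.2 h.2.1, fun h => ⟨Finset.mem_univ j, h.ge, h.le⟩⟩

/-- The index of the block containing a letter. -/
def blockIndex {t : ℕ} {a : Fin t → ℕ} (ha : ∀ i, 0 < a i) (j : Fin t) : Fin (typeLength a) :=
  ⟨a j - 1, by
    have h1 : a j ≤ typeLength a := Finset.le_sup (Finset.mem_univ j)
    have h2 := ha j
    omega⟩

theorem blockIndex_eq_iff {t : ℕ} {a : Fin t → ℕ} (ha : ∀ i, 0 < a i) {j : Fin t}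
    {k : Fin (typeLength a)} : blockIndex ha j = k ↔ a j = k.1 + 1 := by
  have := ha j
  rw [Fin.ext_iff]
  change a j - 1 = k.1 ↔ _
  omega

theorem blockIndex_eq_blockIndex_iff {t : ℕ} {a : Fin t → ℕ} (ha : ∀ i, 0 < a i) {i j : Fin t} :
    blockIndex ha i = blockIndex ha j ↔ a i = a j := by
  have h1 := ha i
  have h2 := ha j
  rw [blockIndex, blockIndex, Fin.mk.injEq]
  omega

theorem card_blockIndex_fiber {t : ℕ} {a : Fin t → ℕ} (ha : ∀ i, 0 < a i)
    (k : Fin (typeLength a)) :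
    Fintype.card {j // blockIndex ha j = k} = hyperplaneType a k := by
  rw [Fintype.card_subtype, hyperplaneType]
  simp only [blockIndex_eq_iff]

theorem mem_block_iff {t : ℕ} {a : Fin t → ℕ} (ha : ∀ i, 0 < a i) (hmono : Monotone a)
    (k : Fin (typeLength a)) (j : Fin t) :
    j ∈ block (hyperplaneType a) k ↔ blockIndex ha j = k :=
  mem_block_iff_of_monotone (fun _ _ hij => Nat.sub_le_sub_right (hmono hij) 1)
    (card_blockIndex_fiber ha) k j

theorem forall_mem_block_iff {t : ℕ} {a : Fin t → ℕ} (ha : ∀ i, 0 < a i) (hmono : Monotone a)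
    (σ : Equiv.Perm (Fin t)) :
    (∀ k j, σ j ∈ block (hyperplaneType a) k ↔ j ∈ block (hyperplaneType a) k) ↔
      ∀ j, blockIndex ha (σ j) = blockIndex ha j := by
  simp only [mem_block_iff ha hmono]
  exact ⟨fun h j => (h _ j).2 rfl, fun h k j => by rw [h j]⟩

theorem hasBlockTypes_iff {t : ℕ} {a : Fin t → ℕ} (ha : ∀ i, 0 < a i) (hmono : Monotone a)
    (μ : ∀ k, (hyperplaneType a k).Partition)
    (σ : {σ : Equiv.Perm (Fin t) // ∀ j, blockIndex ha (σ j) = blockIndex ha j}) :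
    HasBlockTypes μ σ.1 ↔ fiberCycleType (card_blockIndex_fiber ha) σ = μ := by
  rw [fiberCycleType_eq_iff]
  refine forall_congr' fun k => ?_
  have h := fun j => (forall_mem_block_iff ha hmono σ.1).2 σ.2 k j
  rw [exists_prop_of_true h, fullCycleType_eq_of_equiv
    (Equiv.subtypeEquivRight (mem_block_iff ha hmono k)) (h := fiberPermEquiv _ σ k)]
  rintro ⟨j, hj⟩
  rfl

/-! ### Constant-sign symmetries and the average over them -/

/-- The symmetry of `Q_t` with constant sign `s` and underlying permutation `σ`. -/
def constSign {t : ℕ} {a : Fin t → ℕ} {b : ℕ} (ht : 0 < t) (ha : ∀ i, 0 < a i) (s : Bool)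
    (hs : s = true → ∑ i, a i = 2 * b)
    (σ : {σ : Equiv.Perm (Fin t) // ∀ j, blockIndex ha (σ j) = blockIndex ha j}) :
    fixer (hyperplane (le_refl t) a b) :=
  ⟨⟨σ.1, fun _ => s⟩, (mem_fixer_hyperplane_iff ht ha _).2
    ⟨fun j => (blockIndex_eq_blockIndex_iff ha).1 (σ.2 j), by
      cases s
      · exact Or.inl fun _ => rfl
      · exact Or.inr ⟨fun _ => rfl, hs rfl⟩⟩⟩

theorem fOf_constSign_eq {t : ℕ} {a : Fin t → ℕ} {b : ℕ} (ht : 0 < t) (ha : ∀ i, 0 < a i)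
    (s : Bool) (hs : s = true → ∑ i, a i = 2 * b)
    {σ τ : {σ : Equiv.Perm (Fin t) // ∀ j, blockIndex ha (σ j) = blockIndex ha j}}
    (h : fiberCycleType (card_blockIndex_fiber ha) σ =
      fiberCycleType (card_blockIndex_fiber ha) τ) :
    fOf (constSign ht ha s hs σ) = fOf (constSign ht ha s hs τ) := by
  -- Products of signed permutations reverse the order of the underlying permutations, hence
  -- `h.symm`.
  obtain ⟨c, hc⟩ := exists_conj_of_fiberCycleType_eq _ h.symm
  obtain ⟨T, hT⟩ : ∃ T : fixer (hyperplane (le_refl t) a b),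
      T * constSign ht ha s hs σ = constSign ht ha s hs τ * T := by
    -- The conjugator gets all signs `+`: it fixes the hyperplane whatever `δ(H)` is, and it leaves
    -- the constant sign `s` unchanged.
    refine ⟨constSign ht ha false (by simp) c, Subtype.ext (SignedPerm.ext hc.symm ?_)⟩
    funext i
    change xor false s = xor s false
    simp
  have hct := fullCycleType_eq_of_equiv
    (MulAction.toPerm T : Equiv.Perm ↥(vertices t ∩ hyperplane (le_refl t) a b))
    (g := MulAction.toPerm (constSign ht ha s hs σ))
    (h := MulAction.toPerm (constSign ht ha s hs τ)) fun x =>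
      (mul_smul _ _ x).symm.trans ((congrArg (· • x) hT).trans (mul_smul _ _ x))
  funext j
  rw [fOf, fOf, hct]

/-- The common form of `IsFmu` and `IsFmuBar`. -/
theorem exists_constSign_iff {t : ℕ} {a : Fin t → ℕ} {b : ℕ} (ht : 0 < t) (ha : ∀ i, 0 < a i)
    (hmono : Monotone a) (s : Bool) (hs : s = true → ∑ i, a i = 2 * b)
    (μ : ∀ k, (hyperplaneType a k).Partition) (F : ℕ → MvPolynomial ℕ ℚ) :
    (∃ π : fixer (hyperplane (le_refl t) a b),
      ((∀ j, π.1.neg j = s) ∧ ∀ k j, π.1.perm j ∈ block (hyperplaneType a) k ↔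
        j ∈ block (hyperplaneType a) k) ∧ HasBlockTypes μ π.1.perm ∧ F = fOf π) ↔
      ∃ σ, fiberCycleType (card_blockIndex_fiber ha) σ = μ ∧
        F = fOf (constSign (b := b) ht ha s hs σ) := by
  constructor
  · rintro ⟨π, ⟨hneg, hperm⟩, hμ, hF⟩
    have hσ := (forall_mem_block_iff ha hmono _).1 hperm
    refine ⟨⟨π.1.perm, hσ⟩, (hasBlockTypes_iff ha hmono μ ⟨π.1.perm, hσ⟩).1 hμ, ?_⟩
    rw [hF]
    congr 1
    exact Subtype.ext (SignedPerm.ext rfl (funext hneg))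
  · rintro ⟨σ, hσ, hF⟩
    exact ⟨constSign ht ha s hs σ, ⟨fun _ => rfl, (forall_mem_block_iff ha hmono _).2 σ.2⟩,
      (hasBlockTypes_iff ha hmono μ σ).2 hσ, hF⟩

theorem existsUnique_constSign {t : ℕ} {a : Fin t → ℕ} {b : ℕ} (ht : 0 < t) (ha : ∀ i, 0 < a i)
    (s : Bool) (hs : s = true → ∑ i, a i = 2 * b) (μ : ∀ k, (hyperplaneType a k).Partition) :
    ∃! F, ∃ σ, fiberCycleType (card_blockIndex_fiber ha) σ = μ ∧
        F = fOf (constSign (b := b) ht ha s hs σ) := by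
  obtain ⟨σ, hσ⟩ := exists_fiberCycleType_eq (card_blockIndex_fiber ha) μ
  refine ⟨_, ⟨σ, hσ, rfl⟩, ?_⟩
  rintro _ ⟨τ, hτ, rfl⟩
  exact fOf_constSign_eq ht ha s hs (hτ.trans hσ.symm)

/-- The symmetries of `Q_t` fixing the hyperplane: the permutations preserving the blocks, with a
constant sign. -/
noncomputable def constSignEquiv {t : ℕ} {a : Fin t → ℕ} {b : ℕ} (ht : 0 < t)
    (ha : ∀ i, 0 < a i) :
    {s : Bool // s = true → ∑ i, a i = 2 * b} ×
        {σ : Equiv.Perm (Fin t) // ∀ j, blockIndex ha (σ j) = blockIndex ha j} ≃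
      fixer (hyperplane (le_refl t) a b) :=
  Equiv.ofBijective (fun p => constSign ht ha p.1.1 p.1.2 p.2) <| by
    constructor
    · rintro ⟨s, σ⟩ ⟨s', σ'⟩ h
      have h' := congrArg Subtype.val h
      refine Prod.ext (Subtype.ext ?_) (Subtype.ext ?_)
      · exact congrFun (congrArg SignedPerm.neg h') ⟨0, ht⟩
      · exact congrArg SignedPerm.perm h'
    · rintro ⟨w, hw⟩
      have h := (mem_fixer_hyperplane_iff ht ha w).1 hw
      have hσ : ∀ j, blockIndex ha (w.perm j) = blockIndex ha j := fun j =>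
        (blockIndex_eq_blockIndex_iff ha).2 (h.1 j)
      rcases h.2 with h2 | ⟨h2, hb⟩
      · exact ⟨(⟨false, by simp⟩, ⟨w.perm, hσ⟩),
          Subtype.ext (SignedPerm.ext rfl (funext fun j => (h2 j).symm))⟩
      · exact ⟨(⟨true, fun _ => hb⟩, ⟨w.perm, hσ⟩),
          Subtype.ext (SignedPerm.ext rfl (funext fun j => (h2 j).symm))⟩

theorem delta_eq_one_iff {t : ℕ} {a : Fin t → ℕ} {b : ℕ} :
    delta a b = 1 ↔ ∑ i, a i = 2 * b := by
  rw [delta]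
  split_ifs with h <;> simp [h]

theorem sum_subtype_bool {M : Type*} [AddCommMonoid M] (P : Prop) [Decidable P]
    (φ : {s : Bool // s = true → P} → M) :
    ∑ s, φ s = φ ⟨false, by simp⟩ + if h : P then φ ⟨true, fun _ => h⟩ else 0 := by
  by_cases h : P
  · have : (Finset.univ : Finset {s : Bool // s = true → P}) =
        {⟨false, by simp⟩, ⟨true, fun _ => h⟩} := by
      ext ⟨s, hs⟩
      cases s <;> simp
    rw [this, Finset.sum_pair (by simp), dif_pos h]
  · have : (Finset.univ : Finset {s : Bool // s = true → P}) = {⟨false, by simp⟩} := by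
      ext ⟨s, hs⟩
      cases s
      · simp
      · exact absurd (hs rfl) h
    rw [this, Finset.sum_singleton, dif_neg h, add_zero]

/-- The admissible signs number `2 ^ δ(H)`, and each sign contributes one average over
block-preserving permutations. When `δ(H) = 0`, `fbar` is unconstrained and its term is killed by
the coefficient. -/
theorem average_fixer_hyperplane {t : ℕ} {a : Fin t → ℕ} {b : ℕ} (ht : 0 < t)
    (ha : ∀ i, 0 < a i) (Z : MvPolynomial ℕ ℚ)
    (f fbar : (∀ k, (hyperplaneType a k).Partition) → ℕ → MvPolynomial ℕ ℚ)
    (hf : ∀ σ, f (fiberCycleType (card_blockIndex_fiber ha) σ) =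
      fOf (constSign (b := b) ht ha false (by simp) σ))
    (hfbar : ∀ (h : ∑ i, a i = 2 * b) (σ), fbar (fiberCycleType (card_blockIndex_fiber ha) σ) =
      fOf (constSign (b := b) ht ha true (fun _ => h) σ)) :
    MvPolynomial.C (1 / (Fintype.card (fixer (hyperplane (le_refl t) a b)) : ℚ)) *
        ∑ π : fixer (hyperplane (le_refl t) a b), MvPolynomial.bind₁ (fOf π) Z =
      MvPolynomial.C (1 / 2 ^ delta a b) *
        ∑ μ : ∀ k, (hyperplaneType a k).Partition,
          MvPolynomial.C (∏ k, ((zNumber (μ k) : ℚ))⁻¹) *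
            (MvPolynomial.bind₁ (f μ) Z +
              MvPolynomial.C (delta a b : ℚ) * MvPolynomial.bind₁ (fbar μ) Z) := by
  have havg := average_fiberCycleType (R := MvPolynomial ℕ ℚ) (card_blockIndex_fiber ha) fun μ =>
    MvPolynomial.bind₁ (f μ) Z + MvPolynomial.C (delta a b : ℚ) * MvPolynomial.bind₁ (fbar μ) Z
  rw [MvPolynomial.algebraMap_eq] at havg
  rw [← havg, ← mul_assoc, ← MvPolynomial.C_mul, div_mul_div_comm, one_mul,
    ← Fintype.card_congr (constSignEquiv ht ha), ← Equiv.sum_comp (constSignEquiv ht ha),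
    Fintype.card_prod, Fintype.sum_prod_type]
  have hcard : Fintype.card {s : Bool // s = true → ∑ i, a i = 2 * b} = 2 ^ delta a b := by
    rw [← Finset.card_univ, Finset.card_eq_sum_ones, sum_subtype_bool, delta]
    split_ifs <;> rfl
  rw [hcard]
  push_cast
  congr 1
  · congr!
  rw [sum_subtype_bool]
  by_cases h : ∑ i, a i = 2 * b
  · rw [dif_pos h, ← Finset.sum_add_distrib]
    refine Finset.sum_congr (by congr!) fun σ _ => ?_
    rw [hf, hfbar h, delta_eq_one_iff.2 h, Nat.cast_one, MvPolynomial.C_1, one_mul]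
    rfl
  · rw [dif_neg h, add_zero]
    refine Finset.sum_congr (by congr!) fun σ _ => ?_
    rw [hf, delta, if_neg h, Nat.cast_zero, MvPolynomial.C_0, zero_mul, add_zero]
    rfl

end CubeIndex

theorem theorem6p3 {n t : ℕ} (ht : 0 < t) (htn : t ≤ n) (a : Fin t → ℕ) (b : ℕ)
    (ha : ∀ i, 0 < a i) (hmono : Monotone a) (hspan : IsSpanned (hyperplane htn a b)) :
    -- `f_μ` is well defined, and so is its barred version when `δ(H) = 1`
    (∀ μ : ∀ k, (hyperplaneType a k).Partition, ∃! F, IsFmu a b μ F) ∧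
    (delta a b = 1 → ∀ μ : ∀ k, (hyperplaneType a k).Partition, ∃! F, IsFmuBar a b μ F) ∧
    -- the formula for the cycle index
    ∀ f fbar : (∀ k, (hyperplaneType a k).Partition) → ℕ → MvPolynomial ℕ ℚ,
      (∀ μ, IsFmu a b μ (f μ)) →
      (delta a b = 1 → ∀ μ, IsFmuBar a b μ (fbar μ)) →
      hyperplaneCycleIndex (hyperplane htn a b) =
        MvPolynomial.C (1 / 2 ^ delta a b) *
          ∑ μ : ∀ k, (hyperplaneType a k).Partition,
            MvPolynomial.C (∏ k, ((zNumber (μ k) : ℚ))⁻¹) *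
              (MvPolynomial.bind₁ (f μ) (cubeCycleIndex (n - t)) +
                MvPolynomial.C (delta a b : ℚ) *
                  MvPolynomial.bind₁ (fbar μ) (cubeCycleIndex (n - t))) := by
  
  have hfmu : ∀ μ F, IsFmu a b μ F ↔ ∃ σ, fiberCycleType (card_blockIndex_fiber ha) σ = μ ∧
      F = fOf (constSign (b := b) ht ha false (by simp) σ) := fun μ F =>
    exists_constSign_iff ht ha hmono false (by simp) μ F
  have hfmuBar : ∀ (h : ∑ i, a i = 2 * b) (μ F), IsFmuBar a b μ F ↔
      ∃ σ, fiberCycleType (card_blockIndex_fiber ha) σ = μ ∧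
        F = fOf (constSign (b := b) ht ha true (fun _ => h) σ) := fun h μ F =>
    exists_constSign_iff ht ha hmono true (fun _ => h) μ F
  refine ⟨fun μ => ?_, fun hd μ => ?_, fun f fbar hf hfbar => ?_⟩
  · simp only [hfmu]
    exact existsUnique_constSign ht ha false (by simp) μ
  · simp only [hfmuBar (delta_eq_one_iff.1 hd)]
    exact existsUnique_constSign ht ha true _ μ
  · obtain ⟨m, rfl⟩ := Nat.exists_eq_add_of_le htn
    rw [Nat.add_sub_cancel_left, hyperplaneCycleIndex_eq_sum_fixer ht htn b ha]
    -- The given `f μ` may come from a representative other than `σ`; independence of the choice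
    -- identifies the two values.
    refine average_fixer_hyperplane ht ha _ f fbar (fun σ => ?_) (fun h σ => ?_)
    · obtain ⟨τ, hτ, hF⟩ := (hfmu _ _).1 (hf (fiberCycleType (card_blockIndex_fiber ha) σ))
      rw [hF]
      exact fOf_constSign_eq ht ha false (by simp) hτ
    · obtain ⟨τ, hτ, hF⟩ := (hfmuBar h _ _).1
        (hfbar (delta_eq_one_iff.2 h) (fiberCycleType (card_blockIndex_fiber ha) σ))
      rw [hF]
      exact fOf_constSign_eq ht ha true (fun _ => h) hτ
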